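/- Let $G$ be a finite bipartite graph with partite sets $L,R$, edge set $E\subseteq L\times R$ and edge weights $w:E\to[0,\infty)$. Write $w(F)=\sum_{e\in F}w(e)$, and let $\mathrm{OPT}$ be the maximum of $w(M)$ over all matchings $M$ of $G$. Let $0\le p\le 1$. Fix an injective ranking of $L\times R$, chosen independently of the randomness below. Edges are compared by weight, and ties between edges of equal weight are always broken by the ranking; in particular "decreasing order", "highest-weight" and "$w(e)\ge price(r)$" refer to the resulting strict total order of the edges (with distinct weights this is the plain comparison of weights). $\mathrm{Greedy}(H)$ goes through the edges of $H$ in decreasing order and takes every edge that leaves the set of taken edges a matching. Given a sample $L'\subseteq L$, put $M_1=\mathrm{Greedy}(G[L'\cup R])$, and let $price(r)$ be the weight of the edge of $M_1$ at $r$ (no restriction if there is none). To *process* $l\in L\setminus L'$ means: let $e=(l,r)$ be the highest-weight edge at $l$ with $w(e)\ge price(r)$, if any, and add $e$ to $M$ if $M\cup\{e\}$ is a matching. Initially $M=\emptyset$. **SampleAndPermute.** Each $l\in L$ is put into $L'$ independently with probability $p$; then the vertices of $L\setminus L'$ are processed in uniformly random order. **SampleAndPrice** (for Bipartite Vertex-at-a-time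 Matching). The algorithm knows $|L|$ and $R$; the vertices of $L$ arrive in uniformly random order, each revealing on arrival its incident edges with their weights. The algorithm draws $k\sim\mathrm{Binom}(|L|,p)$ independently of the arrival order, lets $L'$ be the first $k$ vertices, and processes every later vertex when it arrives. For the tie-breaking ranking, either (i) the identity of a vertex is revealed on arrival and a fixed ranking of $L\times R$ is used, or (ii) the vertices are anonymous, the algorithm names them on arrival by an independent, uniformly random permutation of $\{0,\dots,|L|-1\}$, and it uses a fixed ranking of $\{0,\dots,|L|-1\}\times R$. Then, whatever the fixed ranking: 1. SampleAndPermute always returns a matching $M$ of $G$, and $\mathbb E[w(M)]\ge \frac{p(1-p)}{2}\,\mathrm{OPT}$. 2. SampleAndPrice is an online algorithm: which edge, if any, it accepts at a given arrival depends only on its internal coins and on the arrivals up to and including that one. It always returns a matching $M$ of $G$, and in both variants (i), (ii), $\mathbb E[w(M)]\ge\frac{p(1-p)}2\,\mathrm{OPT}$. 3. With $p=\frac12$, SampleAndPrice is $8$-competitive in both variants: $\mathrm{OPT}\le 8\,\mathbb E[w(M)]$. 4. This covers the transversal matroid secretary problem. Let each $l\in L$ have a neighbourhood $N(l)\subseteq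 R$ and a weight $v(l)\ge0$, and call $T\subseteq L$ independent if some matching assigns to each $l\in T$ a vertex of $N(l)$, distinct for distinct $l$. Run SampleAndPrice on the graph in which every edge at $l$ has weight $v(l)$, and let $T$ be the set of left vertices covered by the returned matching. Then $T$ is always independent, and for $p=\frac12$ in both variants $8\,\mathbb E\big[\sum_{l\in T}v(l)\big]$ is at least the maximum weight of an independent set. -/

import Mathlib

open scoped NNReal BigOperators

noncomputable section

namespace BVM

/-- What is revealed when a left vertex arrives: for each right vertex `r`, either `none` (no edge
to `r`) or `some` of the nonnegative weight of the edge to `r`. -/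
abbrev Row (R : Type*) := R → Option ℝ≥0

/-- An edge-weighted bipartite graph with partite sets `L` and `R`, given by the row of edges at
each left vertex. -/
abbrev WGraph (L R : Type*) := L → Row R

section Offline

variable {L R : Type*} [Fintype L] [DecidableEq L] [Fintype R] [DecidableEq R]

/-- The edge set of `G`. -/
def edges (G : WGraph L R) : Finset (L × R) :=
  Finset.univ.filter fun e => (G e.1 e.2).isSome = true

/-- The weight of an edge (irrelevant value `0` on pairs that are not edges). -/
def edgeWeight (G : WGraph L R) (e : L × R) : ℝ≥0 := (G e.1 e.2).getD 0

/-- The total weight `w(F)` of a set of edges. -/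
def weight (G : WGraph L R) (F : Finset (L × R)) : ℝ≥0 := ∑ e ∈ F, edgeWeight G e

/-- No two distinct pairs in `M` share an endpoint. -/
def IsMatching (M : Finset (L × R)) : Prop :=
  ∀ e ∈ M, ∀ f ∈ M, (e.1 = f.1 ∨ e.2 = f.2) → e = f

/-- `M` is a matching consisting of edges of `G`. -/
def IsMatchingIn (G : WGraph L R) (M : Finset (L × R)) : Prop :=
  M ⊆ edges G ∧ IsMatching M

open Classical in
/-- The weight of a maximum-weight matching of `G`. -/
def opt (G : WGraph L R) : ℝ≥0 :=
  (Finset.univ.filter fun M : Finset (L × R) => IsMatchingIn G M).sup (weight G)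

/-- The subgraph `G[S ∪ R]` induced by a set `S` of left vertices and all of `R`. -/
def restrict (G : WGraph L R) (S : Finset L) : WGraph L R :=
  fun l r => if l ∈ S then G l r else none

/-- The value by which edges are compared: first by weight; among edges of equal weight, the one
with the smaller value of `tie` counts as heavier. -/
def key (G : WGraph L R) (tie : L × R ↪ ℕ) (e : L × R) : ℝ≥0 ×ₗ ℕᵒᵈ :=
  toLex (edgeWeight G e, OrderDual.toDual (tie e))

/-- The edges of `G`, sorted in decreasing order. -/
def sortedEdges (G : WGraph L R) (tie : L × R ↪ ℕ) : List (L × R) :=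
  (edges G).toList.mergeSort fun e f => decide (key G tie f ≤ key G tie e)

open Classical in
/-- Add `e` to `M` if the result is a matching. -/
def addIfMatching (M : Finset (L × R)) (e : L × R) : Finset (L × R) :=
  if IsMatching (insert e M) then insert e M else M

/-- The greedy matching. -/
def greedy (G : WGraph L R) (tie : L × R ↪ ℕ) : Finset (L × R) :=
  (sortedEdges G tie).foldl addIfMatching ∅

/-- The price of `r` set by a matching `M₁`: the (tie-broken) weight of the edge of `M₁` at `r`,
and `⊥` if there is none. -/
def price (G : WGraph L R) (tie : L × R ↪ ℕ) (M₁ : Finset (L × R)) (r : R) :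
    WithBot (ℝ≥0 ×ₗ ℕᵒᵈ) :=
  ((M₁.filter fun e => e.2 = r).image (key G tie)).max

/-- The highest-weight edge `(l, r)` at `l` whose weight is at least the price of `r`, if any. -/
def bestEdge (G : WGraph L R) (tie : L × R ↪ ℕ) (M₁ : Finset (L × R)) (l : L) :
    Option (L × R) :=
  ((edges G).filter fun e =>
    e.1 = l ∧ price G tie M₁ e.2 ≤ (key G tie e : WithBot (ℝ≥0 ×ₗ ℕᵒᵈ))).toList.argmax (key G tie)

/-- Process one left vertex after sampling: add its best edge if this leaves a matching. -/
def processVertex (G : WGraph L R) (tie : L × R ↪ ℕ) (M₁ M : Finset (L × R)) (l : L) :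
    Finset (L × R) :=
  match bestEdge G tie M₁ l with
  | none => M
  | some e => addIfMatching M e

/-- The matching obtained with sample `S` when the left vertices listed in `order` are processed
one after the other. -/
def sampleThenProcess (G : WGraph L R) (tie : L × R ↪ ℕ) (S : Finset L) (order : List L) :
    Finset (L × R) :=
  order.foldl (processVertex G tie (greedy (restrict G S) tie)) ∅

/-- The matching `M` returned by SampleAndPermute when the sample is `S` and the vertices outside
`S` are processed in the order `π 0, π 1, …`. -/
def sampleAndPermute (G : WGraph L R) (tie : L × R ↪ ℕ) (S : Finset L)
    (π : Fin (Sᶜ).card ≃ {l : L // l ∈ Sᶜ}) : Finset (L × R) :=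
  sampleThenProcess G tie S (List.ofFn fun i => (π i : L))

/-- The expected weight of the matching returned by SampleAndPermute: each left vertex is in the
sample independently with probability `p`, and the order of the others is uniform. -/
def expSampleAndPermute (p : ℝ) (G : WGraph L R) (tie : L × R ↪ ℕ) : ℝ :=
  ∑ S : Finset L, p ^ S.card * (1 - p) ^ (Sᶜ).card *
    𝔼 π : Fin (Sᶜ).card ≃ {l : L // l ∈ Sᶜ}, (weight G (sampleAndPermute G tie S π) : ℝ)

end Offline

section Online

variable {R : Type*} [Fintype R] [DecidableEq R]

/-- The matching returned by SampleAndPrice on a stream of `n` arrivals. Left vertices are named by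
their arrival times, `s i` is the row revealed at time `i`, and `k` is the number of sampled
vertices. -/
def sampleAndPrice {n : ℕ} (s : Fin n → Row R) (tie : Fin n × R ↪ ℕ) (k : ℕ) :
    Finset (Fin n × R) :=
  sampleThenProcess s tie (Finset.univ.filter fun i : Fin n => (i : ℕ) < k)
    ((List.finRange n).filter fun i : Fin n => decide (k ≤ (i : ℕ)))

/-- `A` is a (deterministic) online matching algorithm for `n` arrivals: at time `i` it observes the
row `s i` and the tie-breaking ranks `tie (i, ·)`; it always returns a matching of the revealed
graph, and the edge (if any) that it accepts at a time is determined by the observations up to and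
including that time. -/
def IsOnline {n : ℕ} (A : (Fin n → Row R) → (Fin n × R ↪ ℕ) → Finset (Fin n × R)) : Prop :=
  (∀ s tie, IsMatchingIn s (A s tie)) ∧
  ∀ s s' tie tie', ∀ t : Fin n,
    (∀ i ≤ t, s i = s' i ∧ ∀ r, tie (i, r) = tie' (i, r)) →
      ∀ r, (t, r) ∈ A s tie ↔ (t, r) ∈ A s' tie'

/-- Expectation of `f k` for `k` binomial with parameters `n` and `p`. -/
def binomExp (p : ℝ) (n : ℕ) (f : ℕ → ℝ) : ℝ :=
  ∑ k ∈ Finset.range (n + 1), (n.choose k : ℝ) * p ^ k * (1 - p) ^ (n - k) * f k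

variable {L : Type*} [Fintype L] [DecidableEq L]

/-- The matching of `G` obtained by SampleAndPrice when the left vertices arrive in the order
`σ 0, σ 1, …` and `tie` breaks ties between edges named by arrival times. -/
def runPrice (G : WGraph L R) (σ : Fin (Fintype.card L) ≃ L)
    (tie : Fin (Fintype.card L) × R ↪ ℕ) (k : ℕ) : Finset (L × R) :=
  (sampleAndPrice (fun i => G (σ i)) tie k).image (Prod.map σ id)

/-- Expectation of `f M`, where `M` is the matching returned by SampleAndPrice with parameter `p`
on a uniformly random arrival order, and ties are broken by a fixed ranking of `L × R`. -/
def expPrice (p : ℝ) (G : WGraph L R) (tie : L × R ↪ ℕ) (f : Finset (L × R) → ℝ) : ℝ :=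
  binomExp p (Fintype.card L) fun k =>
    𝔼 σ : Fin (Fintype.card L) ≃ L,
      f (runPrice G σ ((σ.prodCongr (Equiv.refl R)).toEmbedding.trans tie) k)

/-- The same when the names of left vertices are not available: the algorithm draws a uniformly
random permutation `τ`, independent of everything else, calls the `i`-th arriving vertex `τ i`,
and breaks ties by a fixed ranking of `{0, …, |L| - 1} × R`. -/
def expPriceAnonymous (p : ℝ) (G : WGraph L R) (tie : Fin (Fintype.card L) × R ↪ ℕ)
    (f : Finset (L × R) → ℝ) : ℝ :=
  binomExp p (Fintype.card L) fun k =>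
    𝔼 σ : Fin (Fintype.card L) ≃ L, 𝔼 τ : Equiv.Perm (Fin (Fintype.card L)),
      f (runPrice G σ ((τ.prodCongr (Equiv.refl R)).toEmbedding.trans tie) k)

end Online

section Transversal

variable {L R : Type*} [Fintype L] [DecidableEq L] [Fintype R] [DecidableEq R]

/-- Independence in the transversal matroid on `L` of the bipartite graph with neighbourhoods `N`:
some matching covers every vertex of `T`. -/
def TransversalIndep (N : L → Finset R) (T : Finset L) : Prop :=
  ∃ m : {l : L // l ∈ T} → R, Function.Injective m ∧ ∀ l, m l ∈ N l.1

open Classical in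
/-- The maximum `v`-weight of an independent set of the transversal matroid. -/
def transversalOpt (N : L → Finset R) (v : L → ℝ≥0) : ℝ≥0 :=
  (Finset.univ.filter fun T : Finset L => TransversalIndep N T).sup fun T => ∑ l ∈ T, v l

/-- The weighted bipartite graph in which every edge at `l` has weight `v l`. -/
def transversalGraph (N : L → Finset R) (v : L → ℝ≥0) : WGraph L R :=
  fun l r => if r ∈ N l then some (v l) else none

/-- The set of left vertices covered by a matching. -/
def accepted (M : Finset (L × R)) : Finset L := M.image Prod.fst

end Transversal

end BVM

end

open scoped NNReal BigOperators

set_option linter.unusedSectionVars false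

noncomputable section

namespace BVM

section Greedy

variable {L R : Type*} [Fintype L] [DecidableEq L] [Fintype R] [DecidableEq R]

lemma key_injective (G : WGraph L R) (tie : L × R ↪ ℕ) : Function.Injective (key G tie) := by
  intro e f h
  have h2 := congrArg (fun x => OrderDual.ofDual (ofLex x).2) h
  exact tie.injective h2

lemma edgeWeight_le_of_key_le {G : WGraph L R} {tie : L × R ↪ ℕ} {e f : L × R}
    (h : key G tie e ≤ key G tie f) : edgeWeight G e ≤ edgeWeight G f := by
  rcases Prod.Lex.le_iff.1 h with h | h
  · exact le_of_lt h
  · exact le_of_eq h.1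

lemma mem_edges {G : WGraph L R} {e : L × R} : e ∈ edges G ↔ (G e.1 e.2).isSome = true := by
  simp [edges]

lemma mem_edges_restrict {G : WGraph L R} {S : Finset L} {e : L × R} :
    e ∈ edges (restrict G S) ↔ e ∈ edges G ∧ e.1 ∈ S := by
  by_cases h : e.1 ∈ S
  · simp [mem_edges, restrict, h]
  · simp only [mem_edges, restrict, h, if_false, and_false]
    exact iff_of_false Bool.false_ne_true id

lemma key_restrict {G : WGraph L R} {S : Finset L} (tie : L × R ↪ ℕ) {e : L × R} (h : e.1 ∈ S) :
    key (restrict G S) tie e = key G tie e := by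
  simp [key, edgeWeight, restrict, h]

/-- Induction over the edges in decreasing order. -/
lemma key_induction (G : WGraph L R) (tie : L × R ↪ ℕ) {P : L × R → Prop}
    (h : ∀ e, (∀ f, key G tie e < key G tie f → P f) → P e) (e : L × R) : P e := by
  have wf : WellFounded fun f e : L × R => key G tie e < key G tie f :=
    @Finite.wellFounded_of_trans_of_irrefl _ _ _ ⟨fun _ _ _ h₁ h₂ => lt_trans h₂ h₁⟩
      ⟨fun _ => lt_irrefl _⟩
  exact wf.induction e h

lemma isMatching_empty : IsMatching (∅ : Finset (L × R)) := by simp [IsMatching]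

lemma IsMatching.addIfMatching {M : Finset (L × R)} (h : IsMatching M) (e : L × R) :
    IsMatching (addIfMatching M e) := by
  unfold BVM.addIfMatching
  split_ifs with h' <;> assumption

lemma subset_addIfMatching (M : Finset (L × R)) (e : L × R) : M ⊆ addIfMatching M e := by
  unfold addIfMatching
  split_ifs
  · exact Finset.subset_insert _ _
  · exact subset_rfl

lemma addIfMatching_subset (M : Finset (L × R)) (e : L × R) : addIfMatching M e ⊆ insert e M := by
  unfold addIfMatching
  split_ifs
  · exact subset_rfl
  · exact Finset.subset_insert _ _

lemma isMatching_insert {M : Finset (L × R)} (h : IsMatching M) (e : L × R) :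
    IsMatching (insert e M) ↔ ∀ f ∈ M, (f.1 = e.1 ∨ f.2 = e.2) → f = e := by
  constructor
  · intro h' f hf hc
    exact h' f (Finset.mem_insert_of_mem hf) e (Finset.mem_insert_self _ _) hc
  · intro h' a ha b hb hc
    rw [Finset.mem_insert] at ha hb
    rcases ha with rfl | ha <;> rcases hb with rfl | hb
    · rfl
    · exact (h' b hb (hc.imp Eq.symm Eq.symm)).symm
    · exact h' a ha hc
    · exact h a ha b hb hc

lemma mem_addIfMatching_self {M : Finset (L × R)} (h : IsMatching M) (e : L × R) :
    e ∈ addIfMatching M e ↔ ∀ f ∈ M, (f.1 = e.1 ∨ f.2 = e.2) → f = e := by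
  rw [← isMatching_insert h]
  unfold addIfMatching
  split_ifs with h'
  · simp [h']
  · simp only [h', iff_false]
    intro he
    exact h' (by rwa [Finset.insert_eq_of_mem he])

lemma foldl_addIfMatching_spec {K : Type*} [LinearOrder K] (key : L × R → K) (l : List (L × R))
    (hl : l.Pairwise fun e f => key f < key e) :
    IsMatching (l.foldl addIfMatching ∅) ∧
    ∀ e, e ∈ l.foldl addIfMatching ∅ ↔
      e ∈ l ∧ ∀ f ∈ l.foldl addIfMatching ∅, key e < key f → f.1 ≠ e.1 ∧ f.2 ≠ e.2 := by
  induction l using List.reverseRecOn with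
  | nil => simp [isMatching_empty]
  | append_singleton l a ih =>
    rw [List.pairwise_append] at hl
    obtain ⟨hl, -, ha⟩ := hl
    replace ha : ∀ e ∈ l, key a < key e := fun e he => ha e he a (by simp)
    obtain ⟨hM, hspec⟩ := ih hl
    rw [List.foldl_append, List.foldl_cons, List.foldl_nil]
    set M := l.foldl addIfMatching ∅ with hMdef
    have hMl : ∀ e ∈ M, e ∈ l := fun e he => ((hspec e).1 he).1
    have hsub := addIfMatching_subset M a
    have hsup := subset_addIfMatching M a
    refine ⟨hM.addIfMatching a, fun e => ?_⟩
    have hlater : ∀ x, key a ≤ key x → ∀ f ∈ addIfMatching M a, key x < key f → f ∈ M := by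
      intro x hx f hf hlt
      rcases Finset.mem_insert.1 (hsub hf) with rfl | h
      · exact absurd hlt (not_lt.2 hx)
      · exact h
    by_cases hea : e = a
    · subst hea
      rw [mem_addIfMatching_self hM]
      constructor
      · intro h
        refine ⟨by simp, fun f hf hlt => ?_⟩
        have hfM := hlater e le_rfl f hf hlt
        by_contra hc
        have : f = e := h f hfM (by tauto)
        exact absurd hlt (by rw [this]; exact lt_irrefl _)
      · rintro ⟨-, h⟩ f hf hc
        have := h f (hsup hf) (ha f (hMl f hf))
        tauto
    · have hiff : e ∈ addIfMatching M a ↔ e ∈ M := by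
        refine ⟨fun h => ?_, fun h => hsup h⟩
        rcases Finset.mem_insert.1 (hsub h) with h | h
        · exact absurd h hea
        · exact h
      rw [hiff, hspec e]
      simp only [List.mem_append, List.mem_singleton, hea, or_false]
      refine and_congr_right fun hel => ⟨fun h f hf hlt => ?_, fun h f hf hlt => h f (hsup hf) hlt⟩
      exact h f (hlater e (ha e hel).le f hf hlt) hlt

lemma pairwise_sortedEdges (G : WGraph L R) (tie : L × R ↪ ℕ) :
    (sortedEdges G tie).Pairwise fun e f => key G tie f < key G tie e := by
  have h1 : (sortedEdges G tie).Pairwise fun e f => key G tie f ≤ key G tie e := by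
    have := List.pairwise_mergeSort (le := fun e f => decide (key G tie f ≤ key G tie e))
      (fun a b c => by simpa using fun h₁ h₂ => le_trans h₂ h₁)
      (fun a b => by simpa using le_total _ _) (edges G).toList
    simpa [sortedEdges] using this
  have h2 : (sortedEdges G tie).Nodup :=
    (List.mergeSort_perm _ _).nodup_iff.2 (edges G).nodup_toList
  exact (h1.and h2).imp fun h => lt_of_le_of_ne h.1 fun h' => h.2 (key_injective G tie h').symm

lemma mem_sortedEdges {G : WGraph L R} {tie : L × R ↪ ℕ} {e : L × R} :
    e ∈ sortedEdges G tie ↔ e ∈ edges G := by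
  simp [sortedEdges]

lemma isMatching_greedy (G : WGraph L R) (tie : L × R ↪ ℕ) : IsMatching (greedy G tie) :=
  (foldl_addIfMatching_spec _ _ (pairwise_sortedEdges G tie)).1

lemma mem_greedy_iff {G : WGraph L R} {tie : L × R ↪ ℕ} {e : L × R} :
    e ∈ greedy G tie ↔ e ∈ edges G ∧
      ∀ f ∈ greedy G tie, key G tie e < key G tie f → f.1 ≠ e.1 ∧ f.2 ≠ e.2 := by
  rw [← mem_sortedEdges (tie := tie)]
  exact (foldl_addIfMatching_spec _ _ (pairwise_sortedEdges G tie)).2 e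

/-- The greedy matching on the sample. -/
abbrev sampleGreedy (G : WGraph L R) (tie : L × R ↪ ℕ) (S : Finset L) : Finset (L × R) :=
  greedy (restrict G S) tie

lemma mem_sampleGreedy_edges {G : WGraph L R} {tie : L × R ↪ ℕ} {S : Finset L} {e : L × R}
    (h : e ∈ sampleGreedy G tie S) : e ∈ edges G ∧ e.1 ∈ S :=
  mem_edges_restrict.1 (mem_greedy_iff.1 h).1

lemma mem_sampleGreedy_iff {G : WGraph L R} {tie : L × R ↪ ℕ} {S : Finset L} {e : L × R} :
    e ∈ sampleGreedy G tie S ↔ e ∈ edges G ∧ e.1 ∈ S ∧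
      ∀ f ∈ sampleGreedy G tie S, key G tie e < key G tie f → f.1 ≠ e.1 ∧ f.2 ≠ e.2 := by
  rw [sampleGreedy, mem_greedy_iff, mem_edges_restrict, and_assoc]
  refine and_congr_right fun _ => and_congr_right fun he => ?_
  refine forall₂_congr fun f hf => ?_
  rw [key_restrict tie he, key_restrict tie (mem_sampleGreedy_edges hf).2]

/-- The greedy rule determines the greedy matching on the sample. -/
lemma eq_sampleGreedy {G : WGraph L R} {tie : L × R ↪ ℕ} {S : Finset L} {g : Finset (L × R)}
    (h : ∀ e, e ∈ g ↔ e ∈ edges G ∧ e.1 ∈ S ∧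
      ∀ f ∈ g, key G tie e < key G tie f → f.1 ≠ e.1 ∧ f.2 ≠ e.2) :
    g = sampleGreedy G tie S := by
  ext e
  induction e using key_induction G tie with
  | h e ih =>
    rw [h, mem_sampleGreedy_iff]
    refine and_congr_right fun _ => and_congr_right fun _ => forall_congr' fun f => ?_
    constructor
    · intro h hf hlt
      exact h ((ih f hlt).2 hf) hlt
    · intro h hf hlt
      exact h ((ih f hlt).1 hf) hlt

/-- `e` is the heaviest edge at its left vertex whose right vertex is not taken by a heavier edge
of the greedy matching on the sample. -/
def IsCandidate (G : WGraph L R) (tie : L × R ↪ ℕ) (S : Finset L) (e : L × R) : Prop :=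
  e ∈ edges G ∧ (∀ f ∈ sampleGreedy G tie S, key G tie e < key G tie f → f.2 ≠ e.2) ∧
    ∀ e' ∈ edges G, e'.1 = e.1 → key G tie e < key G tie e' →
      ∃ f ∈ sampleGreedy G tie S, key G tie e' < key G tie f ∧ f.2 = e'.2

variable {G : WGraph L R} {tie : L × R ↪ ℕ} {S : Finset L}

lemma mem_sampleGreedy_iff_isCandidate {e : L × R} :
    e ∈ sampleGreedy G tie S ↔ e.1 ∈ S ∧ IsCandidate G tie S e := by
  constructor
  · intro he
    obtain ⟨hE, hS, h⟩ := mem_sampleGreedy_iff.1 he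
    refine ⟨hS, hE, fun f hf hlt => (h f hf hlt).2, fun e' he' h1 hlt => ?_⟩
    by_contra! hc
    refine (h e' (mem_sampleGreedy_iff.2 ⟨he', h1 ▸ hS, fun f hf hlt' =>
      ⟨fun hf1 => ?_, hc f hf hlt'⟩⟩) hlt).1 h1
    exact (h f hf (hlt.trans hlt')).1 (hf1.trans h1)
  · rintro ⟨hS, hE, h2, h1⟩
    refine mem_sampleGreedy_iff.2 ⟨hE, hS, fun f hf hlt => ⟨fun hf1 => ?_, h2 f hf hlt⟩⟩
    obtain ⟨f', hf', hlt', h2'⟩ := h1 f (mem_sampleGreedy_edges hf).1 hf1 hlt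
    exact ((mem_sampleGreedy_iff.1 hf).2.2 f' hf' hlt').2 h2'

lemma IsCandidate.eq {e f : L × R} (he : IsCandidate G tie S e) (hf : IsCandidate G tie S f)
    (h : e.1 = f.1) : e = f := by
  rcases lt_trichotomy (key G tie e) (key G tie f) with hlt | heq | hlt
  · obtain ⟨x, hx, hxl, hx2⟩ := he.2.2 f hf.1 h.symm hlt
    exact absurd hx2 (hf.2.1 x hx hxl)
  · exact key_injective G tie heq
  · obtain ⟨x, hx, hxl, hx2⟩ := hf.2.2 e he.1 h hlt
    exact absurd hx2 (he.2.1 x hx hxl)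

lemma isCandidate_congr {S' : Finset L} {e : L × R}
    (h : ∀ f, key G tie e < key G tie f →
      (f ∈ sampleGreedy G tie S ↔ f ∈ sampleGreedy G tie S')) :
    IsCandidate G tie S e ↔ IsCandidate G tie S' e := by
  refine and_congr_right fun _ => and_congr ?_ ?_
  · refine forall_congr' fun f => ⟨fun H hf hlt => H ((h f hlt).2 hf) hlt, fun H hf hlt =>
      H ((h f hlt).1 hf) hlt⟩
  · refine forall₄_congr fun e' _ _ hlt => exists_congr fun f => ?_
    refine ⟨fun H => ⟨(h f (hlt.trans H.2.1)).1 H.1, H.2⟩, fun H =>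
      ⟨(h f (hlt.trans H.2.1)).2 H.1, H.2⟩⟩

/-- Sampling the left vertex of a candidate does not change the greedy matching above it. -/
lemma IsCandidate.mem_sampleGreedy_insert_iff {e : L × R} (he : IsCandidate G tie S e)
    (f : L × R) (hlt : key G tie e < key G tie f) :
    f ∈ sampleGreedy G tie S ↔ f ∈ sampleGreedy G tie (insert e.1 S) := by
  induction f using key_induction G tie with
  | h f ih =>
    constructor
    · intro hf
      obtain ⟨hE, hS, h⟩ := mem_sampleGreedy_iff.1 hf
      exact mem_sampleGreedy_iff.2 ⟨hE, Finset.mem_insert_of_mem hS, fun x hx hlt' =>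
        h x ((ih x hlt' (hlt.trans hlt')).2 hx) hlt'⟩
    · intro hf
      obtain ⟨hE, hS, h⟩ := mem_sampleGreedy_iff.1 hf
      refine mem_sampleGreedy_iff.2 ⟨hE, ?_, fun x hx hlt' =>
        h x ((ih x hlt' (hlt.trans hlt')).1 hx) hlt'⟩
      rcases Finset.mem_insert.1 hS with hf1 | hS
      · obtain ⟨x, hx, hxl, hx2⟩ := he.2.2 f hE hf1 hlt
        exact absurd hx2 (h x ((ih x hxl (hlt.trans hxl)).1 hx) hxl).2
      · exact hS

/-- Removing the left vertex of an edge of the greedy matching from the sample does not change the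
greedy matching above that edge. -/
lemma mem_sampleGreedy_insert_iff_of_mem {e : L × R}
    (he : e ∈ sampleGreedy G tie (insert e.1 S)) (f : L × R) (hlt : key G tie e < key G tie f) :
    f ∈ sampleGreedy G tie S ↔ f ∈ sampleGreedy G tie (insert e.1 S) := by
  induction f using key_induction G tie with
  | h f ih =>
    constructor
    · intro hf
      obtain ⟨hE, hS, h⟩ := mem_sampleGreedy_iff.1 hf
      exact mem_sampleGreedy_iff.2 ⟨hE, Finset.mem_insert_of_mem hS, fun x hx hlt' =>
        h x ((ih x hlt' (hlt.trans hlt')).2 hx) hlt'⟩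
    · intro hf
      obtain ⟨hE, hS, h⟩ := mem_sampleGreedy_iff.1 hf
      refine mem_sampleGreedy_iff.2 ⟨hE, ?_, fun x hx hlt' =>
        h x ((ih x hlt' (hlt.trans hlt')).1 hx) hlt'⟩
      exact Finset.mem_of_mem_insert_of_ne hS ((mem_sampleGreedy_iff.1 he).2.2 f hf hlt).1

lemma isCandidate_of_mem_insert {e : L × R} (he : e ∈ sampleGreedy G tie (insert e.1 S)) :
    IsCandidate G tie S e :=
  (isCandidate_congr (mem_sampleGreedy_insert_iff_of_mem he)).2
    (mem_sampleGreedy_iff_isCandidate.1 he).2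

lemma IsCandidate.mem_sampleGreedy_insert {e : L × R} (he : IsCandidate G tie S e) :
    e ∈ sampleGreedy G tie (insert e.1 S) :=
  mem_sampleGreedy_iff_isCandidate.2 ⟨Finset.mem_insert_self _ _,
    (isCandidate_congr he.mem_sampleGreedy_insert_iff).1 he⟩

/-- The greedy matching on the sample has at least half the weight of any matching. -/
lemma weight_le_two_mul_weight_sampleGreedy {N : Finset (L × R)} (hN : IsMatching N)
    (hNS : ∀ e ∈ N, e ∈ edges G ∧ e.1 ∈ S) :
    weight G N ≤ 2 * weight G (sampleGreedy G tie S) := by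
  classical
  have hex : ∀ e ∈ N, ∃ f ∈ sampleGreedy G tie S,
      edgeWeight G e ≤ edgeWeight G f ∧ (f.1 = e.1 ∨ f.2 = e.2) := by
    intro e he
    by_cases h : e ∈ sampleGreedy G tie S
    · exact ⟨e, h, le_rfl, Or.inl rfl⟩
    · rw [mem_sampleGreedy_iff] at h
      push Not at h
      obtain ⟨f, hf, hlt, hc⟩ := h (hNS e he).1 (hNS e he).2
      exact ⟨f, hf, edgeWeight_le_of_key_le hlt.le, or_iff_not_imp_left.2 hc⟩
  choose! φ hφ hw hc using hex
  have key1 : ∀ N' ⊆ N, Set.InjOn φ N' → weight G N' ≤ weight G (sampleGreedy G tie S) := by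
    intro N' hN' hinj
    calc weight G N' ≤ ∑ e ∈ N', edgeWeight G (φ e) :=
          Finset.sum_le_sum fun e he => hw e (hN' he)
      _ = ∑ f ∈ N'.image φ, edgeWeight G f := (Finset.sum_image hinj).symm
      _ ≤ _ := Finset.sum_le_sum_of_subset (Finset.image_subset_iff.2 fun e he => hφ e (hN' he))
  have hsplit : weight G N = weight G (N.filter fun e => (φ e).1 = e.1) +
      weight G (N.filter fun e => ¬ (φ e).1 = e.1) :=
    (Finset.sum_filter_add_sum_filter_not _ _ _).symm
  rw [hsplit, two_mul]
  refine add_le_add (key1 _ (Finset.filter_subset _ _) ?_) (key1 _ (Finset.filter_subset _ _) ?_)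
  · intro a ha b hb hab
    simp only [Finset.coe_filter, Set.mem_ofPred_eq] at ha hb
    exact hN a ha.1 b hb.1 (Or.inl (by rw [← ha.2, hab, hb.2]))
  · intro a ha b hb hab
    simp only [Finset.coe_filter, Set.mem_ofPred_eq] at ha hb
    have h1 := (hc a ha.1).resolve_left ha.2
    have h2 := (hc b hb.1).resolve_left hb.2
    exact hN a ha.1 b hb.1 (Or.inr (by rw [← h1, hab, h2]))

end Greedy

section Processing

variable {L R : Type*} [Fintype L] [DecidableEq L] [Fintype R] [DecidableEq R]
variable {G : WGraph L R} {tie : L × R ↪ ℕ} {S : Finset L}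

lemma price_le_key_iff {M₁ : Finset (L × R)} {e : L × R} :
    price G tie M₁ e.2 ≤ (key G tie e : WithBot (ℝ≥0 ×ₗ ℕᵒᵈ)) ↔
      ∀ f ∈ M₁, f.2 = e.2 → key G tie f ≤ key G tie e := by
  unfold price
  rw [Finset.max_le_iff]
  simp only [Finset.mem_image, Finset.mem_filter, WithBot.coe_le_coe]
  constructor
  · intro h f hf h2
    exact h _ ⟨f, ⟨hf, h2⟩, rfl⟩
  · rintro h _ ⟨f, ⟨hf, h2⟩, rfl⟩
    exact h f hf h2

lemma bestEdge_eq_some_iff {M₁ : Finset (L × R)} {l : L} {e : L × R} :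
    bestEdge G tie M₁ l = some e ↔
      (e ∈ edges G ∧ e.1 = l ∧ ∀ f ∈ M₁, f.2 = e.2 → key G tie f ≤ key G tie e) ∧
      ∀ e' ∈ edges G, e'.1 = l → (∀ f ∈ M₁, f.2 = e'.2 → key G tie f ≤ key G tie e') →
        key G tie e' ≤ key G tie e := by
  unfold bestEdge
  rw [List.argmax_eq_some_iff]
  simp only [Finset.mem_toList, Finset.mem_filter, price_le_key_iff]
  constructor
  · rintro ⟨h1, h2, -⟩
    exact ⟨h1, fun e' hE hl hf => h2 e' ⟨hE, hl, hf⟩⟩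
  · rintro ⟨h1, h2⟩
    refine ⟨h1, fun e' h => h2 e' h.1 h.2.1 h.2.2, fun e' h hle => ?_⟩
    rw [key_injective G tie (le_antisymm hle (h2 e' h.1 h.2.1 h.2.2))]

lemma bestEdge_sampleGreedy_eq_some_iff {l : L} {e : L × R} :
    bestEdge G tie (sampleGreedy G tie S) l = some e ↔ e.1 = l ∧ IsCandidate G tie S e := by
  rw [bestEdge_eq_some_iff]
  constructor
  · rintro ⟨⟨hE, hl, hp⟩, hbest⟩
    refine ⟨hl, hE, fun f hf hlt h2 => not_lt.2 (hp f hf h2) hlt, fun e' hE' hl' hlt => ?_⟩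
    by_contra! hc
    exact not_lt.2 (hbest e' hE' (hl'.trans hl) fun f hf h2 => not_lt.1 fun h => hc f hf h h2) hlt
  · rintro ⟨hl, hE, hfree, hbest⟩
    refine ⟨⟨hE, hl, fun f hf h2 => not_lt.1 fun hlt => hfree f hf hlt h2⟩, ?_⟩
    intro e' hE' hl' hp
    by_contra! hlt
    obtain ⟨f, hf, hlt', h2⟩ := hbest e' hE' (hl'.trans hl.symm) hlt
    exact not_lt.2 (hp f hf h2) hlt'

lemma IsMatching.processVertex {M₁ M : Finset (L × R)} (h : IsMatching M) (l : L) :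
    IsMatching (processVertex G tie M₁ M l) := by
  unfold BVM.processVertex
  split
  · exact h
  · exact h.addIfMatching _

lemma subset_processVertex (M₁ M : Finset (L × R)) (l : L) :
    M ⊆ processVertex G tie M₁ M l := by
  unfold processVertex
  split
  · exact subset_rfl
  · exact subset_addIfMatching _ _

lemma mem_processVertex {M₁ M : Finset (L × R)} {l : L} {e : L × R}
    (h : e ∈ processVertex G tie M₁ M l) : e ∈ M ∨ bestEdge G tie M₁ l = some e := by
  unfold processVertex at h
  split at h
  · exact Or.inl h
  · rename_i e' he'
    rcases Finset.mem_insert.1 (addIfMatching_subset _ _ h) with rfl | h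
    · exact Or.inr he'
    · exact Or.inl h

lemma IsMatching.foldl_processVertex {M₁ M : Finset (L × R)} (h : IsMatching M) (order : List L) :
    IsMatching (order.foldl (BVM.processVertex G tie M₁) M) := by
  induction order generalizing M with
  | nil => exact h
  | cons a order ih => exact ih (h.processVertex a)

lemma subset_foldl_processVertex (M₁ M : Finset (L × R)) (order : List L) :
    M ⊆ order.foldl (processVertex G tie M₁) M := by
  induction order generalizing M with
  | nil => exact subset_rfl
  | cons a order ih => exact (subset_processVertex M₁ M a).trans (ih _)

lemma mem_foldl_processVertex {M₁ M : Finset (L × R)} {order : List L} {e : L × R}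
    (h : e ∈ order.foldl (processVertex G tie M₁) M) :
    e ∈ M ∨ ∃ l ∈ order, bestEdge G tie M₁ l = some e := by
  induction order generalizing M with
  | nil => exact Or.inl h
  | cons a order ih =>
    rcases ih h with h | ⟨l, hl, h⟩
    · exact (mem_processVertex h).imp_right fun h => ⟨a, by simp, h⟩
    · exact Or.inr ⟨l, by simp [hl], h⟩

lemma exists_conflict_mem_foldl_processVertex {M₁ M : Finset (L × R)} (hM : IsMatching M)
    {order : List L} {l : L} (hl : l ∈ order) {e : L × R} (he : bestEdge G tie M₁ l = some e) :
    ∃ f ∈ order.foldl (processVertex G tie M₁) M, f.1 = e.1 ∨ f.2 = e.2 := by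
  induction order generalizing M with
  | nil => simp at hl
  | cons a order ih =>
    rcases List.mem_cons.1 hl with rfl | hl
    · have : ∃ f ∈ processVertex G tie M₁ M l, f.1 = e.1 ∨ f.2 = e.2 := by
        unfold processVertex
        rw [he]
        by_cases h : e ∈ addIfMatching M e
        · exact ⟨e, h, Or.inl rfl⟩
        · rw [mem_addIfMatching_self hM] at h
          push Not at h
          obtain ⟨f, hf, hc, -⟩ := h
          exact ⟨f, subset_addIfMatching M e hf, hc⟩
      obtain ⟨f, hf, hc⟩ := this
      exact ⟨f, subset_foldl_processVertex _ _ order hf, hc⟩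
    · exact ih (hM.processVertex a) hl

lemma isMatchingIn_sampleThenProcess (G : WGraph L R) (tie : L × R ↪ ℕ) (S : Finset L)
    (order : List L) : IsMatchingIn G (sampleThenProcess G tie S order) := by
  refine ⟨fun e he => ?_, isMatching_empty.foldl_processVertex order⟩
  rcases mem_foldl_processVertex he with he | ⟨l, -, h⟩
  · simp at he
  · exact (bestEdge_eq_some_iff.1 h).1.1

/-- A candidate at a vertex outside the sample. -/
def IsOffer (G : WGraph L R) (tie : L × R ↪ ℕ) (S : Finset L) (e : L × R) : Prop :=
  e.1 ∉ S ∧ IsCandidate G tie S e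

/-- The lightest offer at its right vertex. -/
def IsLastOffer (G : WGraph L R) (tie : L × R ↪ ℕ) (S : Finset L) (e : L × R) : Prop :=
  IsOffer G tie S e ∧ ∀ f, IsOffer G tie S f → f.2 = e.2 → key G tie e ≤ key G tie f

open Classical in
/-- The total weight of the lightest offers at the right vertices. -/
def lastOfferWeight (G : WGraph L R) (tie : L × R ↪ ℕ) (S : Finset L) : ℝ≥0 :=
  weight G (Finset.univ.filter (IsLastOffer G tie S))

/-- Whatever the order, every right vertex with an offer accepts one of its offers. -/
lemma lastOfferWeight_le_weight_sampleThenProcess {order : List L}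
    (horder : ∀ l, l ∈ order ↔ l ∉ S) :
    lastOfferWeight G tie S ≤ weight G (sampleThenProcess G tie S order) := by
  classical
  set M := sampleThenProcess G tie S order with hM
  have hoffer : ∀ f ∈ M, IsOffer G tie S f := by
    intro f hf
    rcases mem_foldl_processVertex hf with hf | ⟨l, hl, h⟩
    · simp at hf
    · obtain ⟨rfl, hc⟩ := bestEdge_sampleGreedy_eq_some_iff.1 h
      exact ⟨(horder _).1 hl, hc⟩
  have hex : ∀ e, IsLastOffer G tie S e → ∃ f ∈ M, f.2 = e.2 := by
    intro e he
    obtain ⟨f, hf, hc⟩ := exists_conflict_mem_foldl_processVertex isMatching_empty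
      ((horder e.1).2 he.1.1) (bestEdge_sampleGreedy_eq_some_iff.2 ⟨rfl, he.1.2⟩)
    refine ⟨f, hf, hc.elim (fun h => ?_) id⟩
    rw [(hoffer f hf).2.eq he.1.2 h]
  choose! φ hφ h2 using hex
  have hinj : Set.InjOn φ (Finset.univ.filter (IsLastOffer G tie S) : Finset (L × R)) := by
    intro a ha b hb hab
    simp only [Finset.coe_filter, Finset.mem_univ, true_and, Set.mem_ofPred_eq] at ha hb
    have h : a.2 = b.2 := by rw [← h2 a ha, hab, h2 b hb]
    exact key_injective G tie (le_antisymm (ha.2 b hb.1 h.symm) (hb.2 a ha.1 h))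
  calc lastOfferWeight G tie S
      ≤ ∑ e ∈ Finset.univ.filter (IsLastOffer G tie S), edgeWeight G (φ e) := by
        refine Finset.sum_le_sum fun e he => ?_
        have he : IsLastOffer G tie S e := by simpa using he
        exact edgeWeight_le_of_key_le (he.2 _ (hoffer _ (hφ e he)) (h2 e he))
    _ = ∑ f ∈ (Finset.univ.filter (IsLastOffer G tie S)).image φ, edgeWeight G f :=
        (Finset.sum_image hinj).symm
    _ ≤ weight G M := by
        refine Finset.sum_le_sum_of_subset (Finset.image_subset_iff.2 fun e he => ?_)
        exact hφ e (by simpa using he)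

end Processing

section Sampling

variable {L R : Type*} [Fintype L] [DecidableEq L] [Fintype R] [DecidableEq R]
variable {G : WGraph L R} {tie : L × R ↪ ℕ} {S : Finset L}

/-- The probability that the sample is `S`. -/
def sampleProb (p : ℝ) (S : Finset L) : ℝ := p ^ S.card * (1 - p) ^ (Sᶜ).card

lemma sampleProb_nonneg {p : ℝ} (h0 : 0 ≤ p) (h1 : p ≤ 1) (S : Finset L) : 0 ≤ sampleProb p S :=
  mul_nonneg (pow_nonneg h0 _) (pow_nonneg (sub_nonneg.2 h1) _)

lemma sampleProb_insert (p : ℝ) {l : L} (hl : l ∉ S) :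
    p * sampleProb p S = (1 - p) * sampleProb p (insert l S) := by
  have h : (Sᶜ).card = ((insert l S)ᶜ).card + 1 := by
    rw [Finset.compl_insert, Finset.card_erase_add_one (Finset.mem_compl.2 hl)]
  rw [sampleProb, sampleProb, Finset.card_insert_of_notMem hl, h]
  ring

lemma sum_sampleProb (p : ℝ) : ∑ S : Finset L, sampleProb p S = 1 := by
  have := Fintype.sum_pow_mul_eq_add_pow L p (1 - p)
  simpa [sampleProb, Finset.card_compl] using this

lemma sum_sampleProb_mem (p : ℝ) (l : L) :
    ∑ S : Finset L with l ∈ S, sampleProb p S = p := by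
  have hswap : p * ∑ S : Finset L with l ∉ S, sampleProb p S =
      (1 - p) * ∑ S : Finset L with l ∈ S, sampleProb p S := by
    rw [Finset.mul_sum, Finset.mul_sum]
    refine Finset.sum_bij' (fun S _ => insert l S) (fun S _ => S.erase l) ?_ ?_ ?_ ?_ ?_
    · simp
    · simp
    · intro S hS
      exact Finset.erase_insert (by simpa using hS)
    · intro S hS
      exact Finset.insert_erase (by simpa using hS)
    · intro S hS
      exact sampleProb_insert p (by simpa using hS)
  have htot := Finset.sum_filter_add_sum_filter_not (Finset.univ : Finset (Finset L))
    (fun S => l ∈ S) (sampleProb p)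
  rw [sum_sampleProb] at htot
  linear_combination p * htot - hswap

/-- An edge is an offer at least as often, relative to the odds of its left vertex, as it is in the
greedy matching on the sample. -/
lemma sum_mem_sampleGreedy_le {p : ℝ} (h0 : 0 ≤ p) (h1 : p ≤ 1) (e : L × R)
    [DecidablePred fun S => IsOffer G tie S e] :
    (1 - p) * ∑ S with e ∈ sampleGreedy G tie S, sampleProb p S ≤
      p * ∑ S with IsOffer G tie S e, sampleProb p S := by
  rw [Finset.mul_sum, Finset.mul_sum]
  have hmem : ∀ S ∈ Finset.univ.filter fun S => e ∈ sampleGreedy G tie S, e.1 ∈ S := fun S hS =>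
    (mem_sampleGreedy_edges (by simpa using hS : e ∈ sampleGreedy G tie S)).2
  have hinj : Set.InjOn (fun S : Finset L => S.erase e.1)
      (Finset.univ.filter fun S => e ∈ sampleGreedy G tie S) := by
    intro S hS T hT h
    rw [← Finset.insert_erase (hmem S hS), ← Finset.insert_erase (hmem T hT)]
    exact congrArg (insert e.1) h
  calc _ = ∑ S with e ∈ sampleGreedy G tie S, p * sampleProb p (S.erase e.1) := by
        refine Finset.sum_congr rfl fun S hS => ?_
        rw [sampleProb_insert p (Finset.notMem_erase e.1 S), Finset.insert_erase (hmem S hS)]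
    _ = ∑ T ∈ (Finset.univ.filter fun S => e ∈ sampleGreedy G tie S).image (·.erase e.1),
          p * sampleProb p T :=
        (Finset.sum_image (f := fun T => p * sampleProb p T) hinj).symm
    _ ≤ _ := by
        refine Finset.sum_le_sum_of_subset_of_nonneg (Finset.image_subset_iff.2 fun S hS => ?_)
          fun T _ _ => mul_nonneg h0 (sampleProb_nonneg h0 h1 T)
        refine Finset.mem_filter.2 ⟨Finset.mem_univ _, Finset.notMem_erase _ _,
          isCandidate_of_mem_insert ?_⟩
        rw [Finset.insert_erase (hmem S hS)]
        simpa using hS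

/-- If `e` is an offer but not the lightest at its right vertex, then sampling the left vertex of
the next lighter offer makes `e` the lightest one. -/
lemma exists_isLastOffer_insert {e : L × R} (he : IsOffer G tie S e)
    (hlast : ¬ IsLastOffer G tie S e) :
    ∃ l ∉ S, IsLastOffer G tie (insert l S) e ∧ (l, e.2) ∈ sampleGreedy G tie (insert l S) := by
  classical
  let B := Finset.univ.filter fun f => IsOffer G tie S f ∧ f.2 = e.2 ∧ key G tie f < key G tie e
  have hB : B.Nonempty := by
    simp only [IsLastOffer, he, true_and] at hlast
    push Not at hlast
    obtain ⟨f, hf, h2, hlt⟩ := hlast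
    exact ⟨f, by simp [B, hf, h2, hlt]⟩
  obtain ⟨f, hfB, hmax⟩ := B.exists_max_image (key G tie) hB
  obtain ⟨-, hf, hf2, hflt⟩ := Finset.mem_filter.1 hfB
  have hagree := hf.2.mem_sampleGreedy_insert_iff
  have hcand : ∀ x, key G tie f < key G tie x →
      (IsCandidate G tie S x ↔ IsCandidate G tie (insert f.1 S) x) := fun x hx =>
    isCandidate_congr fun y hy => hagree y (hx.trans hy)
  have hfmem := hf.2.mem_sampleGreedy_insert
  have hne : e.1 ≠ f.1 := fun h => hflt.ne' (by rw [he.2.eq hf.2 h])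
  refine ⟨f.1, hf.1, ⟨⟨?_, (hcand e hflt).1 he.2⟩, fun x hx hx2 => ?_⟩, ?_⟩
  · simp [hne, he.1]
  · by_contra! hlt
    have hxS : x.1 ∉ insert f.1 S := hx.1
    have hfx : key G tie f < key G tie x := by
      refine lt_of_le_of_ne (not_lt.1 fun h => hx.2.2.1 f hfmem h (hf2.trans hx2.symm)) fun h => ?_
      exact hxS (by rw [key_injective G tie h]; exact Finset.mem_insert_self _ _)
    have hxB : x ∈ B := by
      refine Finset.mem_filter.2 ⟨Finset.mem_univ _, ⟨?_, (hcand x hfx).2 hx.2⟩, hx2, hlt⟩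
      exact fun h => hxS (Finset.mem_insert_of_mem h)
    exact not_lt.2 (hmax x hxB) hfx
  · rw [← hf2]
    exact hfmem

/-- An offer is the lightest one at its right vertex with conditional probability at least `p`. -/
lemma mul_sum_isOffer_le {p : ℝ} (h0 : 0 ≤ p) (h1 : p ≤ 1) (e : L × R)
    [DecidablePred fun S => IsOffer G tie S e] [DecidablePred fun S => IsLastOffer G tie S e] :
    p * ∑ S with IsOffer G tie S e, sampleProb p S ≤
      ∑ S with IsLastOffer G tie S e, sampleProb p S := by
  classical
  have hsplit := Finset.sum_filter_add_sum_filter_not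
    (Finset.univ.filter fun S => IsOffer G tie S e) (fun S => IsLastOffer G tie S e) (sampleProb p)
  have hA : (Finset.univ.filter fun S => IsOffer G tie S e).filter (fun S => IsLastOffer G tie S e)
      = Finset.univ.filter fun S => IsLastOffer G tie S e := by
    ext S
    simp only [Finset.mem_filter, Finset.mem_univ, true_and, and_iff_right_iff_imp]
    exact fun h => h.1
  rw [hA] at hsplit
  set B := (Finset.univ.filter fun S => IsOffer G tie S e).filter
    fun S => ¬ IsLastOffer G tie S e with hB
  have hex : ∀ S ∈ B, ∃ l ∉ S, IsLastOffer G tie (insert l S) e ∧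
      (l, e.2) ∈ sampleGreedy G tie (insert l S) := fun S hS => by
    simp only [hB, Finset.mem_filter, Finset.mem_univ, true_and] at hS
    exact exists_isLastOffer_insert hS.1 hS.2
  have : Nonempty L := ⟨e.1⟩
  choose! φ hφ hlast hmem using hex
  have hinj : Set.InjOn (fun S => insert (φ S) S) B := by
    intro S hS T hT h
    simp only at h
    have h' : φ S = φ T := by
      have := hmem S hS
      rw [h] at this
      exact congrArg Prod.fst (isMatching_greedy _ _ _ this _ (hmem T hT) (Or.inr rfl))
    rw [← Finset.erase_insert (hφ S hS), ← Finset.erase_insert (hφ T hT), h, h']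
  have hle : p * ∑ S ∈ B, sampleProb p S ≤
      (1 - p) * ∑ S with IsLastOffer G tie S e, sampleProb p S := by
    rw [Finset.mul_sum, Finset.mul_sum]
    calc _ = ∑ S ∈ B, (1 - p) * sampleProb p (insert (φ S) S) :=
          Finset.sum_congr rfl fun S hS => sampleProb_insert p (hφ S hS)
      _ = ∑ T ∈ B.image (fun S => insert (φ S) S), (1 - p) * sampleProb p T :=
          (Finset.sum_image (f := fun T => (1 - p) * sampleProb p T) hinj).symm
      _ ≤ _ := Finset.sum_le_sum_of_subset_of_nonneg
          (Finset.image_subset_iff.2 fun S hS => by simpa using hlast S hS)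
          fun T _ _ => mul_nonneg (sub_nonneg.2 h1) (sampleProb_nonneg h0 h1 T)
  rw [← hsplit]
  linarith

lemma sum_sampleProb_mul_sum {p : ℝ} (P : Finset L → L × R → Prop) [∀ S e, Decidable (P S e)]
    (w : L × R → ℝ) :
    ∑ S, sampleProb p S * ∑ e with P S e, w e = ∑ e, w e * ∑ S with P S e, sampleProb p S := by
  simp only [Finset.sum_filter, Finset.mul_sum]
  rw [Finset.sum_comm]
  refine Finset.sum_congr rfl fun e _ => Finset.sum_congr rfl fun S _ => ?_
  split_ifs <;> ring

lemma isMatchingIn_empty (G : WGraph L R) : IsMatchingIn G ∅ :=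
  ⟨Finset.empty_subset _, isMatching_empty⟩

lemma exists_weight_eq_opt (G : WGraph L R) : ∃ N, IsMatchingIn G N ∧ weight G N = opt G := by
  classical
  obtain ⟨N, hN, h⟩ := Finset.exists_mem_eq_sup
    (Finset.univ.filter fun M : Finset (L × R) => IsMatchingIn G M)
    ⟨∅, by simp [isMatchingIn_empty]⟩ (weight G)
  refine ⟨N, by simpa using hN, ?_⟩
  rw [opt, ← h]

lemma weight_le_opt {N : Finset (L × R)} (hN : IsMatchingIn G N) : weight G N ≤ opt G := by
  classical
  exact Finset.le_sup (f := weight G) (by simpa using hN)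

lemma opt_le_expected_weight_sampleGreedy {p : ℝ} (h0 : 0 ≤ p) (h1 : p ≤ 1) (G : WGraph L R)
    (tie : L × R ↪ ℕ) :
    p / 2 * (opt G : ℝ) ≤ ∑ S, sampleProb p S * (weight G (sampleGreedy G tie S) : ℝ) := by
  classical
  obtain ⟨N, hN, hopt⟩ := exists_weight_eq_opt G
  have hN' : p * (opt G : ℝ) =
      ∑ S, sampleProb p S * (weight G (N.filter fun e => e.1 ∈ S) : ℝ) := by
    have := sum_sampleProb_mul_sum (p := p) (fun S e => e ∈ N ∧ e.1 ∈ S)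
      fun e => (edgeWeight G e : ℝ)
    have hset : ∀ S : Finset L, N.filter (fun e => e.1 ∈ S) =
        Finset.univ.filter fun e => e ∈ N ∧ e.1 ∈ S := fun S => by ext; simp
    simp only [weight, NNReal.coe_sum, hset]
    rw [this, ← hopt, weight, NNReal.coe_sum, Finset.mul_sum, ← Finset.sum_filter_add_sum_filter_not
      Finset.univ (fun e => e ∈ N), Finset.filter_univ_mem, Finset.sum_eq_zero (s := Finset.filter _ _),
      add_zero]
    · refine Finset.sum_congr rfl fun e he => ?_
      simp only [he, true_and, sum_sampleProb_mem]
      ring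
    · intro e he
      have he : e ∉ N := by simpa using he
      simp [he]
  have : p * (opt G : ℝ) ≤
      ∑ S, sampleProb p S * (2 * (weight G (sampleGreedy G tie S) : ℝ)) := by
    rw [hN']
    refine Finset.sum_le_sum fun S _ => mul_le_mul_of_nonneg_left ?_ (sampleProb_nonneg h0 h1 S)
    have := weight_le_two_mul_weight_sampleGreedy (G := G) (tie := tie) (S := S)
      (N := N.filter fun e => e.1 ∈ S)
      (fun e he f hf => hN.2 e (Finset.mem_filter.1 he).1 f (Finset.mem_filter.1 hf).1)
      fun e he => ⟨hN.1 (Finset.mem_filter.1 he).1, (Finset.mem_filter.1 he).2⟩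
    exact_mod_cast this
  have h2 : ∑ S, sampleProb p S * (2 * (weight G (sampleGreedy G tie S) : ℝ)) =
      2 * ∑ S, sampleProb p S * (weight G (sampleGreedy G tie S) : ℝ) := by
    rw [Finset.mul_sum]
    exact Finset.sum_congr rfl fun S _ => by ring
  linarith

theorem opt_le_expected_lastOfferWeight {p : ℝ} (h0 : 0 ≤ p) (h1 : p ≤ 1) (G : WGraph L R)
    (tie : L × R ↪ ℕ) :
    p * (1 - p) / 2 * (opt G : ℝ) ≤ ∑ S, sampleProb p S * (lastOfferWeight G tie S : ℝ) := by
  classical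
  calc p * (1 - p) / 2 * (opt G : ℝ)
      = (1 - p) * (p / 2 * (opt G : ℝ)) := by ring
    _ ≤ (1 - p) * ∑ S, sampleProb p S * (weight G (sampleGreedy G tie S) : ℝ) :=
        mul_le_mul_of_nonneg_left (opt_le_expected_weight_sampleGreedy h0 h1 G tie)
          (sub_nonneg.2 h1)
    _ = ∑ e, (edgeWeight G e : ℝ) *
          ((1 - p) * ∑ S with e ∈ sampleGreedy G tie S, sampleProb p S) := by
        have := sum_sampleProb_mul_sum (p := p) (fun S e => e ∈ sampleGreedy G tie S)
          fun e => (edgeWeight G e : ℝ)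
        simp only [Finset.filter_univ_mem] at this
        simp only [weight, NNReal.coe_sum, this, Finset.mul_sum (a := 1 - p)]
        exact Finset.sum_congr rfl fun e _ => by rw [← Finset.mul_sum]; ring
    _ ≤ ∑ e, (edgeWeight G e : ℝ) * ∑ S with IsLastOffer G tie S e, sampleProb p S :=
        Finset.sum_le_sum fun e _ => mul_le_mul_of_nonneg_left
          ((sum_mem_sampleGreedy_le h0 h1 e).trans (mul_sum_isOffer_le h0 h1 e)) (by positivity)
    _ = _ := by
        rw [← sum_sampleProb_mul_sum]
        simp only [lastOfferWeight, weight, NNReal.coe_sum]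

end Sampling

section Renaming

variable {L L' R : Type*} [Fintype L] [DecidableEq L] [Fintype L'] [DecidableEq L']
  [Fintype R] [DecidableEq R]

/-- The ranking of `L' × R` induced by a ranking of `L × R` and a bijection `L' ≃ L`. -/
def pullTie (σ : L' ≃ L) (tie : L × R ↪ ℕ) : L' × R ↪ ℕ :=
  (σ.prodCongr (Equiv.refl R)).toEmbedding.trans tie

lemma pullTie_pullTie {L'' : Type*} (σ : L'' ≃ L') (ρ : L' ≃ L) (tie : L × R ↪ ℕ) :
    pullTie σ (pullTie ρ tie) = pullTie (σ.trans ρ) tie := rfl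

variable (σ : L' ≃ L) (G : WGraph L R) (tie : L × R ↪ ℕ) (S : Finset L')

lemma mem_edges_comp {e : L' × R} :
    e ∈ edges (fun i => G (σ i)) ↔ σ.prodCongr (Equiv.refl R) e ∈ edges G := by
  simp [mem_edges]

lemma key_comp (e : L' × R) :
    key (fun i => G (σ i)) (pullTie σ tie) e = key G tie (σ.prodCongr (Equiv.refl R) e) := rfl

lemma mem_sampleGreedy_comp {e : L' × R} :
    e ∈ sampleGreedy (fun i => G (σ i)) (pullTie σ tie) S ↔
      σ.prodCongr (Equiv.refl R) e ∈ sampleGreedy G tie (S.map σ.toEmbedding) := by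
  induction e using key_induction (fun i => G (σ i)) (pullTie σ tie) with
  | h e ih =>
    rw [mem_sampleGreedy_iff, mem_sampleGreedy_iff, mem_edges_comp,
      (σ.prodCongr (Equiv.refl R)).surjective.forall]
    refine and_congr_right fun _ => and_congr (by simp) (forall_congr' fun f => ?_)
    rw [← key_comp, ← key_comp]
    constructor
    · intro h hf hlt
      simpa using h ((ih f hlt).2 hf) hlt
    · intro h hf hlt
      simpa using h ((ih f hlt).1 hf) hlt

lemma isCandidate_comp {e : L' × R} :
    IsCandidate (fun i => G (σ i)) (pullTie σ tie) S e ↔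
      IsCandidate G tie (S.map σ.toEmbedding) (σ.prodCongr (Equiv.refl R) e) := by
  unfold IsCandidate
  simp only [(σ.prodCongr (Equiv.refl R)).surjective.forall,
    (σ.prodCongr (Equiv.refl R)).surjective.exists, mem_edges_comp, mem_sampleGreedy_comp, key_comp]
  simp

lemma isLastOffer_comp {e : L' × R} :
    IsLastOffer (fun i => G (σ i)) (pullTie σ tie) S e ↔
      IsLastOffer G tie (S.map σ.toEmbedding) (σ.prodCongr (Equiv.refl R) e) := by
  unfold IsLastOffer IsOffer
  simp only [(σ.prodCongr (Equiv.refl R)).surjective.forall, isCandidate_comp, key_comp]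
  simp

lemma lastOfferWeight_comp :
    lastOfferWeight (fun i => G (σ i)) (pullTie σ tie) S =
      lastOfferWeight G tie (S.map σ.toEmbedding) := by
  unfold lastOfferWeight weight
  refine Finset.sum_equiv (σ.prodCongr (Equiv.refl R)) (fun e => ?_) fun e _ => rfl
  simp only [Finset.mem_filter, Finset.mem_univ, true_and]
  exact isLastOffer_comp σ G tie S

lemma weight_image_comp (M : Finset (L' × R)) :
    weight G (M.image (Prod.map σ id)) = weight (fun i => G (σ i)) M :=
  Finset.sum_image fun _ _ _ _ h => (σ.prodCongr (Equiv.refl R)).injective h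

lemma IsMatchingIn.image_comp {M : Finset (L' × R)} (hM : IsMatchingIn (fun i => G (σ i)) M) :
    IsMatchingIn G (M.image (Prod.map σ id)) := by
  constructor
  · intro e he
    obtain ⟨x, hx, rfl⟩ := Finset.mem_image.1 he
    exact (mem_edges_comp σ G).1 (hM.1 hx)
  · intro a ha b hb hab
    obtain ⟨x, hx, rfl⟩ := Finset.mem_image.1 ha
    obtain ⟨y, hy, rfl⟩ := Finset.mem_image.1 hb
    rw [hM.2 x hx y hy (by simpa using hab)]

end Renaming

section Online

variable {R : Type*} [Fintype R] [DecidableEq R]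

lemma mem_arrivals {n k : ℕ} (i : Fin n) :
    i ∈ (List.finRange n).filter (fun i : Fin n => decide (k ≤ (i : ℕ))) ↔
      i ∉ Finset.univ.filter fun i : Fin n => (i : ℕ) < k := by
  simp

lemma sampleGreedy_congr {L : Type*} [Fintype L] [DecidableEq L] {G G' : WGraph L R}
    {tie tie' : L × R ↪ ℕ} {S : Finset L} (hG : ∀ l ∈ S, G l = G' l)
    (htie : ∀ l ∈ S, ∀ r, tie (l, r) = tie' (l, r)) :
    sampleGreedy G tie S = sampleGreedy G' tie' S := by
  refine eq_sampleGreedy fun e => ?_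
  rw [mem_sampleGreedy_iff]
  have hkey : ∀ f : L × R, f.1 ∈ S → key G tie f = key G' tie' f := fun f hf => by
    simp only [key, edgeWeight, hG _ hf]
    rw [htie _ hf f.2]
  constructor
  · rintro ⟨hE, hS, h⟩
    refine ⟨by rwa [mem_edges, ← hG _ hS, ← mem_edges], hS, fun f hf => ?_⟩
    rw [← hkey e hS, ← hkey f (mem_sampleGreedy_edges hf).2]
    exact h f hf
  · rintro ⟨hE, hS, h⟩
    refine ⟨by rwa [mem_edges, hG _ hS, ← mem_edges], hS, fun f hf => ?_⟩
    rw [hkey e hS, hkey f (mem_sampleGreedy_edges hf).2]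
    exact h f hf

lemma bestEdge_congr {L : Type*} [Fintype L] [DecidableEq L] {G G' : WGraph L R}
    {tie tie' : L × R ↪ ℕ} {M₁ : Finset (L × R)} {l : L} (hG : G l = G' l)
    (hkey : ∀ e : L × R, e.1 = l ∨ e ∈ M₁ → key G tie e = key G' tie' e) :
    bestEdge G tie M₁ l = bestEdge G' tie' M₁ l := by
  unfold bestEdge
  have hset : ((edges G).filter fun e =>
      e.1 = l ∧ price G tie M₁ e.2 ≤ (key G tie e : WithBot (ℝ≥0 ×ₗ ℕᵒᵈ))) =
      (edges G').filter fun e =>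
        e.1 = l ∧ price G' tie' M₁ e.2 ≤ (key G' tie' e : WithBot (ℝ≥0 ×ₗ ℕᵒᵈ)) := by
    ext e
    simp only [Finset.mem_filter, price_le_key_iff]
    by_cases hl : e.1 = l
    · rw [mem_edges, mem_edges, hl, hG, hkey e (Or.inl hl)]
      refine and_congr_right fun _ => and_congr_right fun _ => forall₂_congr fun f hf => ?_
      rw [hkey f (Or.inr hf)]
    · simp [hl]
  rw [hset]
  ext e
  simp only [List.argmax_eq_some_iff]
  have hkey' : ∀ a ∈ ((edges G').filter fun e =>
      e.1 = l ∧ price G' tie' M₁ e.2 ≤ (key G' tie' e : WithBot (ℝ≥0 ×ₗ ℕᵒᵈ))).toList,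
      key G tie a = key G' tie' a := fun a ha =>
    hkey a (Or.inl (Finset.mem_filter.1 (Finset.mem_toList.1 ha)).2.1)
  refine and_congr_right fun he => and_congr (forall₂_congr fun a ha => ?_)
    (forall₂_congr fun a ha => ?_)
  · rw [hkey' a ha, hkey' e he]
  · rw [hkey' a ha, hkey' e he]

lemma mem_foldl_processVertex_filter_iff {n : ℕ} {G : WGraph (Fin n) R} {tie : Fin n × R ↪ ℕ}
    {M₁ : Finset (Fin n × R)} {order : List (Fin n)} (horder : order.Pairwise (· < ·))
    (t : Fin n) (r : R) (M : Finset (Fin n × R)) :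
    (t, r) ∈ order.foldl (processVertex G tie M₁) M ↔
      (t, r) ∈ (order.filter fun i => decide (i ≤ t)).foldl (processVertex G tie M₁) M := by
  induction order generalizing M with
  | nil => simp
  | cons a order ih =>
    obtain ⟨ha, horder⟩ := List.pairwise_cons.1 horder
    by_cases hat : a ≤ t
    · simp only [List.filter_cons, hat, decide_true, if_true, List.foldl_cons]
      exact ih horder _
    · have hnil : (a :: order).filter (fun i => decide (i ≤ t)) = [] := by
        refine List.filter_eq_nil_iff.2 fun b hb => ?_
        rcases List.mem_cons.1 hb with rfl | hb
        · simpa using hat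
        · simpa using (not_le.1 hat).trans (ha b hb)
      rw [hnil, List.foldl_nil]
      refine ⟨fun h => ?_, fun h => subset_foldl_processVertex _ _ _ h⟩
      rcases mem_foldl_processVertex h with h | ⟨l, hl, h⟩
      · exact h
      · have hlt : t = l := (bestEdge_eq_some_iff.1 h).1.2.1
        subst hlt
        rcases List.mem_cons.1 hl with rfl | hl
        · exact absurd le_rfl hat
        · exact absurd (ha _ hl).le hat

theorem isOnline_sampleAndPrice (n k : ℕ) :
    IsOnline (R := R) (n := n) fun s tie => sampleAndPrice s tie k := by
  refine ⟨fun s tie => isMatchingIn_sampleThenProcess _ _ _ _, ?_⟩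
  intro s s' tie tie' t hagree r
  have hord : ((List.finRange n).filter fun i : Fin n => decide (k ≤ (i : ℕ))).Pairwise (· < ·) :=
    List.Pairwise.filter _ (List.pairwise_lt_finRange n)
  unfold sampleAndPrice sampleThenProcess
  by_cases htk : (t : ℕ) < k
  · have hnot : ∀ (s : Fin n → Row R) (tie : Fin n × R ↪ ℕ) (M₁ : Finset (Fin n × R)),
        (t, r) ∉ ((List.finRange n).filter fun i : Fin n => decide (k ≤ (i : ℕ))).foldl
          (processVertex s tie M₁) ∅ := by
      intro s tie M₁ h
      rcases mem_foldl_processVertex h with h | ⟨l, hl, h⟩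
      · simp at h
      · have hlt : t = l := (bestEdge_eq_some_iff.1 h).1.2.1
        subst hlt
        simp only [List.mem_filter, decide_eq_true_eq] at hl
        omega
    exact iff_of_false (hnot _ _ _) (hnot _ _ _)
  · have hS : ∀ i ∈ Finset.univ.filter (fun i : Fin n => (i : ℕ) < k), i ≤ t := by
      intro i hi
      have : (i : ℕ) < k := by simpa using hi
      exact Fin.le_def.2 (by omega)
    have hg := sampleGreedy_congr (G := s) (G' := s') (tie := tie) (tie' := tie')
      (fun i hi => (hagree i (hS i hi)).1) (fun i hi => (hagree i (hS i hi)).2)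
    have hkey : ∀ e : Fin n × R, e.1 ≤ t → key s tie e = key s' tie' e := fun e he => by
      simp only [key, edgeWeight, (hagree _ he).1]
      rw [(hagree _ he).2 e.2]
    rw [mem_foldl_processVertex_filter_iff hord, mem_foldl_processVertex_filter_iff hord]
    rw [show greedy (restrict s _) tie = _ from hg]
    rw [List.foldl_ext (processVertex s tie _) (processVertex s' tie' _) ∅ fun M l hl => ?_]
    have hl : l ≤ t := by simpa using (List.mem_filter.1 hl).2
    unfold processVertex
    rw [bestEdge_congr (hagree l hl).1]
    rintro e (he | he)
    · exact hkey e (he.trans_le hl)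
    · exact hkey e (hS _ (mem_sampleGreedy_edges he).2)

end Online

section Expectation

variable {L R : Type*} [Fintype L] [DecidableEq L] [Fintype R] [DecidableEq R]

/-- The first `k` vertices in the order `σ`. -/
def firstArrivals (σ : Fin (Fintype.card L) ≃ L) (k : ℕ) : Finset L :=
  (Finset.univ.filter fun i : Fin (Fintype.card L) => (i : ℕ) < k).map σ.toEmbedding

lemma card_firstArrivals_eq {k : ℕ} (hk : k ≤ Fintype.card L) (S : Finset L) :
    (Finset.univ.filter fun σ : Fin (Fintype.card L) ≃ L => firstArrivals σ k = S).card =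
      if S.card = k then k.factorial * (Fintype.card L - k).factorial else 0 := by
  have hcard : ∀ σ : Fin (Fintype.card L) ≃ L, (firstArrivals σ k).card = k := fun σ => by
    rw [firstArrivals, Finset.card_map, Fin.card_filter_val_lt, min_eq_right hk]
  split_ifs with hS
  · rw [← hS, ← Numbering.card_prefixed S]
    refine Finset.card_bij' (fun σ _ => σ.symm) (fun f _ => f.symm) ?_ ?_ ?_ ?_
    · intro σ hσ
      have hσ : firstArrivals σ S.card = S := by simpa [hS] using hσ
      refine Numbering.mem_prefixed.2 fun x => ?_
      nth_rw 1 [← hσ]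
      simp [firstArrivals]
    · intro f hf
      have hf := Numbering.mem_prefixed.1 hf
      refine Finset.mem_filter.2 ⟨Finset.mem_univ _, ?_⟩
      ext x
      simp [firstArrivals, hf x]
    · simp
    · simp
  · refine Finset.card_eq_zero.2 (Finset.filter_eq_empty_iff.2 fun σ _ h => hS ?_)
    rw [← h, hcard]

lemma choose_mul_expect_firstArrivals {k : ℕ} (hk : k ≤ Fintype.card L) (F : Finset L → ℝ) :
    ((Fintype.card L).choose k : ℝ) *
      (𝔼 σ : Fin (Fintype.card L) ≃ L, F (firstArrivals σ k)) =
      ∑ S : Finset L with S.card = k, F S := by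
  have hsum : ∑ σ : Fin (Fintype.card L) ≃ L, F (firstArrivals σ k) =
      (k.factorial * (Fintype.card L - k).factorial : ℕ) * ∑ S : Finset L with S.card = k, F S := by
    rw [← Finset.sum_fiberwise (s := Finset.univ) (g := fun σ => firstArrivals σ k), Finset.mul_sum,
      Finset.sum_filter]
    refine Finset.sum_congr rfl fun S _ => ?_
    rw [Finset.sum_congr rfl (g := fun _ => F S) fun σ hσ => by rw [(Finset.mem_filter.1 hσ).2],
      Finset.sum_const, card_firstArrivals_eq hk]
    split_ifs <;> simp
  have hcard : Fintype.card (Fin (Fintype.card L) ≃ L) = (Fintype.card L).factorial := by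
    rw [Fintype.card_equiv (Fintype.equivFin L).symm, Fintype.card_fin]
  rw [Fintype.expect_eq_sum_div_card, hsum, hcard, ← Nat.choose_mul_factorial_mul_factorial hk]
  have h1 : (k.factorial : ℝ) ≠ 0 := by exact_mod_cast k.factorial_ne_zero
  have h2 : ((Fintype.card L - k).factorial : ℝ) ≠ 0 := by
    exact_mod_cast (Fintype.card L - k).factorial_ne_zero
  have h3 : ((Fintype.card L).choose k : ℝ) ≠ 0 := by
    exact_mod_cast (Nat.choose_pos hk).ne'
  push_cast
  field_simp

/-- The first `Binom(|L|, p)` vertices of a uniformly random order form a sample in which every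
vertex is included independently with probability `p`. -/
lemma binomExp_expect_firstArrivals (p : ℝ) (F : Finset L → ℝ) :
    binomExp p (Fintype.card L)
      (fun k => 𝔼 σ : Fin (Fintype.card L) ≃ L, F (firstArrivals σ k)) =
      ∑ S, sampleProb p S * F S := by
  rw [← Finset.sum_fiberwise_of_maps_to (s := Finset.univ) (g := Finset.card)
    (t := Finset.range (Fintype.card L + 1))
    (fun S _ => Finset.mem_range_succ_iff.2 (Finset.card_le_univ S)), binomExp]
  refine Finset.sum_congr rfl fun k hk => ?_
  have hk := Finset.mem_range_succ_iff.1 hk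
  rw [Finset.sum_congr rfl (g := fun S => p ^ k * (1 - p) ^ (Fintype.card L - k) * F S)
    fun S hS => by rw [sampleProb, Finset.card_compl, (Finset.mem_filter.1 hS).2],
    ← Finset.mul_sum, ← choose_mul_expect_firstArrivals hk]
  ring

lemma binomExp_mono {p : ℝ} (h0 : 0 ≤ p) (h1 : p ≤ 1) {n : ℕ} {f g : ℕ → ℝ}
    (h : ∀ k, f k ≤ g k) : binomExp p n f ≤ binomExp p n g := by
  have := sub_nonneg.2 h1
  exact Finset.sum_le_sum fun k _ => mul_le_mul_of_nonneg_left (h k) (by positivity)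

lemma isMatchingIn_runPrice (G : WGraph L R) (σ : Fin (Fintype.card L) ≃ L)
    (tie : Fin (Fintype.card L) × R ↪ ℕ) (k : ℕ) : IsMatchingIn G (runPrice G σ tie k) :=
  IsMatchingIn.image_comp σ G (isMatchingIn_sampleThenProcess _ _ _ _)

lemma lastOfferWeight_le_weight_runPrice (G : WGraph L R) (σ : Fin (Fintype.card L) ≃ L)
    (tie : L × R ↪ ℕ) (k : ℕ) :
    lastOfferWeight G tie (firstArrivals σ k) ≤ weight G (runPrice G σ (pullTie σ tie) k) := by
  rw [firstArrivals, ← lastOfferWeight_comp, runPrice, weight_image_comp]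
  exact lastOfferWeight_le_weight_sampleThenProcess mem_arrivals

theorem opt_le_expSampleAndPermute {p : ℝ} (h0 : 0 ≤ p) (h1 : p ≤ 1) (G : WGraph L R)
    (tie : L × R ↪ ℕ) : p * (1 - p) / 2 * (opt G : ℝ) ≤ expSampleAndPermute p G tie := by
  refine (opt_le_expected_lastOfferWeight h0 h1 G tie).trans (Finset.sum_le_sum fun S _ =>
    mul_le_mul_of_nonneg_left ?_ (sampleProb_nonneg h0 h1 S))
  have : Nonempty (Fin (Sᶜ).card ≃ {l : L // l ∈ Sᶜ}) := ⟨(Sᶜ).equivFin.symm⟩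
  refine Finset.le_expect Finset.univ_nonempty fun π _ => ?_
  refine NNReal.coe_le_coe.2 (lastOfferWeight_le_weight_sampleThenProcess fun l => ?_)
  rw [List.mem_ofFn, ← Finset.mem_compl]
  constructor
  · rintro ⟨i, rfl⟩
    exact (π i).2
  · intro hl
    exact ⟨π.symm ⟨l, hl⟩, by simp⟩

theorem opt_le_expPrice {p : ℝ} (h0 : 0 ≤ p) (h1 : p ≤ 1) (G : WGraph L R) (tie : L × R ↪ ℕ) :
    p * (1 - p) / 2 * (opt G : ℝ) ≤ expPrice p G tie fun M => (weight G M : ℝ) := by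
  refine (opt_le_expected_lastOfferWeight h0 h1 G tie).trans ?_
  rw [← binomExp_expect_firstArrivals p fun S => (lastOfferWeight G tie S : ℝ)]
  exact binomExp_mono h0 h1 fun k => Finset.expect_le_expect fun σ _ =>
    NNReal.coe_le_coe.2 (lastOfferWeight_le_weight_runPrice G σ tie k)

/-- Naming the arriving vertices at random amounts to ranking the edges by a random renaming of
the left vertices, drawn independently of the arrival order. -/
lemma expPriceAnonymous_eq_expect (p : ℝ) (G : WGraph L R) (tie : Fin (Fintype.card L) × R ↪ ℕ)
    (f : Finset (L × R) → ℝ) :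
    expPriceAnonymous p G tie f =
      𝔼 ρ : L ≃ Fin (Fintype.card L), expPrice p G (pullTie ρ tie) f := by
  have hk : ∀ k, (𝔼 ρ : L ≃ Fin (Fintype.card L), 𝔼 σ : Fin (Fintype.card L) ≃ L,
      f (runPrice G σ (pullTie σ (pullTie ρ tie)) k)) =
      𝔼 σ : Fin (Fintype.card L) ≃ L, 𝔼 τ : Equiv.Perm (Fin (Fintype.card L)),
        f (runPrice G σ (pullTie τ tie) k) := by
    intro k
    rw [Finset.expect_comm]
    refine Finset.expect_congr rfl fun σ _ => ?_
    refine Fintype.expect_equiv (Equiv.equivCongr σ.symm (Equiv.refl _)) _ _ fun ρ => ?_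
    rw [pullTie_pullTie]
    rfl
  calc expPriceAnonymous p G tie f
      = binomExp p (Fintype.card L) fun k => 𝔼 ρ : L ≃ Fin (Fintype.card L),
          𝔼 σ : Fin (Fintype.card L) ≃ L, f (runPrice G σ (pullTie σ (pullTie ρ tie)) k) := by
        simp only [hk]
        rfl
    _ = 𝔼 ρ : L ≃ Fin (Fintype.card L), binomExp p (Fintype.card L) fun k =>
          𝔼 σ : Fin (Fintype.card L) ≃ L, f (runPrice G σ (pullTie σ (pullTie ρ tie)) k) := by
        simp only [binomExp]
        rw [Finset.expect_sum_comm]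
        exact Finset.sum_congr rfl fun k _ => Finset.mul_expect _ _ _
    _ = _ := rfl

theorem opt_le_expPriceAnonymous {p : ℝ} (h0 : 0 ≤ p) (h1 : p ≤ 1) (G : WGraph L R)
    (tie : Fin (Fintype.card L) × R ↪ ℕ) :
    p * (1 - p) / 2 * (opt G : ℝ) ≤ expPriceAnonymous p G tie fun M => (weight G M : ℝ) := by
  rw [expPriceAnonymous_eq_expect]
  have : Nonempty (L ≃ Fin (Fintype.card L)) := ⟨Fintype.equivFin L⟩
  exact Finset.le_expect Finset.univ_nonempty fun ρ _ => opt_le_expPrice h0 h1 G _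

theorem opt_le_eight_mul_expPrice (G : WGraph L R) (tie : L × R ↪ ℕ) :
    (opt G : ℝ) ≤ 8 * expPrice (1 / 2) G tie fun M => (weight G M : ℝ) := by
  have := opt_le_expPrice (p := 1 / 2) (by norm_num) (by norm_num) G tie
  linarith

theorem opt_le_eight_mul_expPriceAnonymous (G : WGraph L R)
    (tie : Fin (Fintype.card L) × R ↪ ℕ) :
    (opt G : ℝ) ≤ 8 * expPriceAnonymous (1 / 2) G tie fun M => (weight G M : ℝ) := by
  have := opt_le_expPriceAnonymous (p := 1 / 2) (by norm_num) (by norm_num) G tie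
  linarith

lemma expPrice_congr (p : ℝ) {G : WGraph L R} (tie : L × R ↪ ℕ) {f g : Finset (L × R) → ℝ}
    (h : ∀ M, IsMatchingIn G M → f M = g M) : expPrice p G tie f = expPrice p G tie g := by
  simp only [expPrice, h _ (isMatchingIn_runPrice G _ _ _)]

lemma expPriceAnonymous_congr (p : ℝ) {G : WGraph L R} (tie : Fin (Fintype.card L) × R ↪ ℕ)
    {f g : Finset (L × R) → ℝ} (h : ∀ M, IsMatchingIn G M → f M = g M) :
    expPriceAnonymous p G tie f = expPriceAnonymous p G tie g := by
  simp only [expPriceAnonymous, h _ (isMatchingIn_runPrice G _ _ _)]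

end Expectation

section Transversal

variable {L R : Type*} [Fintype L] [DecidableEq L] [Fintype R] [DecidableEq R]
variable {N : L → Finset R} {v : L → ℝ≥0}

lemma mem_edges_transversalGraph {e : L × R} :
    e ∈ edges (transversalGraph N v) ↔ e.2 ∈ N e.1 := by
  by_cases h : e.2 ∈ N e.1
  · simp only [mem_edges, transversalGraph, h, if_true, iff_true]
    rfl
  · simp only [mem_edges, transversalGraph, h, if_false]
    exact iff_of_false Bool.false_ne_true id

lemma edgeWeight_transversalGraph {e : L × R} (h : e.2 ∈ N e.1) :
    edgeWeight (transversalGraph N v) e = v e.1 := by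
  simp only [edgeWeight, transversalGraph, h, if_true]
  rfl

lemma transversalIndep_accepted {M : Finset (L × R)}
    (hM : IsMatchingIn (transversalGraph N v) M) : TransversalIndep N (accepted M) := by
  have hex : ∀ l : {l : L // l ∈ accepted M}, ∃ r, (l.1, r) ∈ M := by
    rintro ⟨l, hl⟩
    obtain ⟨e, he, rfl⟩ := Finset.mem_image.1 hl
    exact ⟨e.2, he⟩
  choose m hm using hex
  refine ⟨m, fun a b hab => ?_, fun l => mem_edges_transversalGraph.1 (hM.1 (hm l))⟩
  exact Subtype.ext (congrArg Prod.fst (hM.2 _ (hm a) _ (hm b) (Or.inr hab)))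

lemma weight_transversalGraph {M : Finset (L × R)}
    (hM : IsMatchingIn (transversalGraph N v) M) :
    weight (transversalGraph N v) M = ∑ l ∈ accepted M, v l := by
  rw [accepted, Finset.sum_image fun a ha b hb h => hM.2 a ha b hb (Or.inl h)]
  exact Finset.sum_congr rfl fun e he =>
    edgeWeight_transversalGraph (mem_edges_transversalGraph.1 (hM.1 he))

lemma transversalOpt_le_opt (N : L → Finset R) (v : L → ℝ≥0) :
    transversalOpt N v ≤ opt (transversalGraph N v) := by
  classical
  refine Finset.sup_le fun T hT => ?_
  obtain ⟨m, hinj, hm⟩ : TransversalIndep N T := by simpa using hT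
  let M : Finset (L × R) := Finset.univ.image fun l : {l : L // l ∈ T} => (l.1, m l)
  have hM : IsMatchingIn (transversalGraph N v) M := by
    constructor
    · intro e he
      obtain ⟨l, -, rfl⟩ := Finset.mem_image.1 he
      exact mem_edges_transversalGraph.2 (hm l)
    · intro a ha b hb hab
      obtain ⟨l, -, rfl⟩ := Finset.mem_image.1 ha
      obtain ⟨l', -, rfl⟩ := Finset.mem_image.1 hb
      have : l = l' := hab.elim (fun h => Subtype.ext h) fun h => hinj h
      rw [this]
  have hacc : accepted M = T := by
    ext l
    simp [accepted, M]
  rw [← hacc, ← weight_transversalGraph hM]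
  exact weight_le_opt hM

lemma coe_weight_transversalGraph {M : Finset (L × R)}
    (hM : IsMatchingIn (transversalGraph N v) M) :
    ∑ l ∈ accepted M, (v l : ℝ) = (weight (transversalGraph N v) M : ℝ) := by
  rw [weight_transversalGraph hM, NNReal.coe_sum]

theorem transversalOpt_le_eight_mul_expPrice (N : L → Finset R) (v : L → ℝ≥0)
    (tie : L × R ↪ ℕ) :
    (transversalOpt N v : ℝ) ≤ 8 * expPrice (1 / 2) (transversalGraph N v) tie
      fun M => ∑ l ∈ accepted M, (v l : ℝ) := by
  rw [expPrice_congr _ _ fun M hM => coe_weight_transversalGraph hM]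
  exact (NNReal.coe_le_coe.2 (transversalOpt_le_opt N v)).trans (opt_le_eight_mul_expPrice _ tie)

theorem transversalOpt_le_eight_mul_expPriceAnonymous (N : L → Finset R) (v : L → ℝ≥0)
    (tie : Fin (Fintype.card L) × R ↪ ℕ) :
    (transversalOpt N v : ℝ) ≤ 8 * expPriceAnonymous (1 / 2) (transversalGraph N v) tie
      fun M => ∑ l ∈ accepted M, (v l : ℝ) := by
  rw [expPriceAnonymous_congr _ _ fun M hM => coe_weight_transversalGraph hM]
  exact (NNReal.coe_le_coe.2 (transversalOpt_le_opt N v)).trans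
    (opt_le_eight_mul_expPriceAnonymous _ tie)

end Transversal

end BVM

end

theorem mainTheorem1 {L R : Type*} [Fintype L] [DecidableEq L] [Fintype R] [DecidableEq R] :
    -- SampleAndPermute returns a matching
    (∀ (G : BVM.WGraph L R) (tie : L × R ↪ ℕ) (S : Finset L)
      (π : Fin (Sᶜ).card ≃ {l : L // l ∈ Sᶜ}),
      BVM.IsMatchingIn G (BVM.sampleAndPermute G tie S π)) ∧
    -- the bound for SampleAndPermute
    (∀ (p : ℝ), 0 ≤ p → p ≤ 1 → ∀ (G : BVM.WGraph L R) (tie : L × R ↪ ℕ),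
      p * (1 - p) / 2 * (BVM.opt G : ℝ) ≤ BVM.expSampleAndPermute p G tie) ∧
    -- SampleAndPrice is an online algorithm, and returns a matching of `G`
    (∀ n k : ℕ, BVM.IsOnline (R := R) (n := n) fun s tie => BVM.sampleAndPrice s tie k) ∧
    (∀ (G : BVM.WGraph L R) (σ : Fin (Fintype.card L) ≃ L)
      (tie : Fin (Fintype.card L) × R ↪ ℕ) (k : ℕ),
      BVM.IsMatchingIn G (BVM.runPrice G σ tie k)) ∧
    -- the bound for SampleAndPrice
    (∀ (p : ℝ), 0 ≤ p → p ≤ 1 → ∀ (G : BVM.WGraph L R),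
      (∀ tie : L × R ↪ ℕ, p * (1 - p) / 2 * (BVM.opt G : ℝ) ≤
        BVM.expPrice p G tie fun M => (BVM.weight G M : ℝ)) ∧
      (∀ tie : Fin (Fintype.card L) × R ↪ ℕ, p * (1 - p) / 2 * (BVM.opt G : ℝ) ≤
        BVM.expPriceAnonymous p G tie fun M => (BVM.weight G M : ℝ))) ∧
    -- with `p = 1/2`, SampleAndPrice is 8-competitive
    (∀ (G : BVM.WGraph L R),
      (∀ tie : L × R ↪ ℕ, (BVM.opt G : ℝ) ≤
        8 * BVM.expPrice (1 / 2) G tie fun M => (BVM.weight G M : ℝ)) ∧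
      (∀ tie : Fin (Fintype.card L) × R ↪ ℕ, (BVM.opt G : ℝ) ≤
        8 * BVM.expPriceAnonymous (1 / 2) G tie fun M => (BVM.weight G M : ℝ))) ∧
    -- hence an 8-competitive algorithm for the transversal matroid secretary problem
    (∀ (N : L → Finset R) (v : L → ℝ≥0),
      (∀ (σ : Fin (Fintype.card L) ≃ L) (tie : Fin (Fintype.card L) × R ↪ ℕ) (k : ℕ),
        BVM.TransversalIndep N
          (BVM.accepted (BVM.runPrice (BVM.transversalGraph N v) σ tie k))) ∧
      (∀ tie : L × R ↪ ℕ, (BVM.transversalOpt N v : ℝ) ≤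
        8 * BVM.expPrice (1 / 2) (BVM.transversalGraph N v) tie
          fun M => ∑ l ∈ BVM.accepted M, (v l : ℝ)) ∧
      (∀ tie : Fin (Fintype.card L) × R ↪ ℕ, (BVM.transversalOpt N v : ℝ) ≤
        8 * BVM.expPriceAnonymous (1 / 2) (BVM.transversalGraph N v) tie
          fun M => ∑ l ∈ BVM.accepted M, (v l : ℝ))) := by
  refine ⟨fun G tie S π => BVM.isMatchingIn_sampleThenProcess G tie S _,
    fun p h0 h1 G tie => BVM.opt_le_expSampleAndPermute h0 h1 G tie,
    BVM.isOnline_sampleAndPrice, BVM.isMatchingIn_runPrice,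
    fun p h0 h1 G => ⟨BVM.opt_le_expPrice h0 h1 G, BVM.opt_le_expPriceAnonymous h0 h1 G⟩,
    fun G => ⟨BVM.opt_le_eight_mul_expPrice G, BVM.opt_le_eight_mul_expPriceAnonymous G⟩,
    fun N v => ⟨fun σ tie k => BVM.transversalIndep_accepted (BVM.isMatchingIn_runPrice _ σ tie k),
      BVM.transversalOpt_le_eight_mul_expPrice N v,
      BVM.transversalOpt_le_eight_mul_expPriceAnonymous N v⟩⟩
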